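/- Theorem 4.1. Let $K$ be a compact metric space, and let $C(K)$ be the Banach space of continuous real-valued functions on $K$ with the supremum norm. Let $B_1(K)$ be the set of all $F:K\to\mathbb R$ that are pointwise limits of uniformly bounded sequences in $C(K)$. Let $DSC(K)$ be the set of all $F:K\to\mathbb R$ for which there is a uniformly bounded sequence $(f_n)_{n\ge 0}\subseteq C(K)$ converging pointwise to $F$ with $$\sum_{n=0}^\infty |f_{n+1}(k)-f_n(k)|<\infty\qquad\text{for every }k\in K .$$ A function $F\in B_1(K)$ is said to govern a class $\mathcal C$ of Banach spaces if, whenever $(f_n)\subseteq C(K)$ is a uniformly bounded sequence converging pointwise to $F$, some $Y\in\mathcal C$ is isomorphic (linearly homeomorphic) to a subspace of the closed linear span $[(f_n)]$ of $(f_n)$ in $C(K)$. If $F\in DSC(K)\setminus C(K)$, then $F$ governs $\{c_0\}$, where $c_0$ is the Banach space of real null sequences with the supremum norm. That is, $F\in B_1(K)$, and the closed linear span of every uniformly bounded sequence in $C(K)$ converging pointwise to $F$ contains a subspace isomorphic to $c_0$. -/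

import Mathlib

open scoped ZeroAtInfty

/-- The sequence `f` in `C(K)` is uniformly bounded and converges pointwise on `K` to `F`. -/
def BoundedlyConvergesTo {K : Type*} [TopologicalSpace K] (f : ℕ → C(K, ℝ)) (F : K → ℝ) : Prop :=
  (∃ M : ℝ, ∀ n k, |f n k| ≤ M) ∧
    ∀ k, Filter.Tendsto (fun n => f n k) Filter.atTop (nhds (F k))

/-- The class `B₁(K)` of pointwise limits of uniformly bounded, pointwise convergent sequences of
continuous real functions on `K`. -/
def BaireOne (K : Type*) [TopologicalSpace K] : Set (K → ℝ) :=
  {F | ∃ f : ℕ → C(K, ℝ), BoundedlyConvergesTo f F}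

/-- The class `DSC(K)`: pointwise limits of uniformly bounded sequences `(f n)` in `C(K)` such that
`∑ |f (n + 1) k - f n k| < ∞` for every `k` in `K` (no bound uniform in `k` is asked for). -/
def DSC (K : Type*) [TopologicalSpace K] : Set (K → ℝ) :=
  {F | ∃ f : ℕ → C(K, ℝ), BoundedlyConvergesTo f F ∧
    ∀ k, Summable (fun n => |f (n + 1) k - f n k|)}

/-- The closed linear span of a sequence in a real normed space. -/
def closedSpan {X : Type*} [NormedAddCommGroup X] [NormedSpace ℝ X] (x : ℕ → X) :
    Submodule ℝ X :=
  (Submodule.span ℝ (Set.range x)).topologicalClosure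

/-- `Y` embeds into `X`: it is linearly homeomorphic to a linear subspace of `X`. (If `Y` is
complete, such a subspace is automatically closed.) -/
def EmbedsInto (Y X : Type*) [NormedAddCommGroup Y] [NormedSpace ℝ Y]
    [NormedAddCommGroup X] [NormedSpace ℝ X] : Prop :=
  ∃ Z : Submodule ℝ X, Nonempty (Y ≃L[ℝ] Z)

/-- A function `F` in `B₁(K)` governs a class of Banach spaces, given as a family `Y`, if for
every uniformly bounded sequence in `C(K)` (sup norm) converging pointwise to `F`, some member
of the class embeds into the closed linear span of the sequence. -/
def Governs {K : Type*} [TopologicalSpace K] [CompactSpace K] (F : K → ℝ)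
    {ι : Type*} (Y : ι → Type*) [∀ i, NormedAddCommGroup (Y i)] [∀ i, NormedSpace ℝ (Y i)] :
    Prop :=
  F ∈ BaireOne K ∧
    ∀ f : ℕ → C(K, ℝ), BoundedlyConvergesTo f F → ∃ i, EmbedsInto (Y i) (closedSpan f)

/-! Let `g` be bounded with pointwise limit `F`, and let `f` witness `F ∈ DSC K`. Since `f n - g n`
is bounded and pointwise null, it is weakly null, so by Mazur's theorem convex blocks of `g` stay
uniformly close to the same blocks of `f` and inherit their pointwise finite variation
(`exists_blocks_summable`). The closed span `X` of `g` therefore contains a pointwise absolutely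
summable series `x` with discontinuous sum.

It remains to find `c₀` in such an `X` (`embedsInto_of_pointwise_summable`). If `X` has no copy of
`c₀`, a gliding hump argument gives every series in `X` with bounded absolute sums uniformly small
tails (`embedsInto_of_not_uniform`). Build such a series `y` greedily, each term almost as large as
a weighted bound on `∑ |y j|` allows. The weight exceeds 1 everywhere, so the continuous sum `∑ |y
j|` stays below 1 by a positive margin. Yet `X` contains functions of fixed norm that are tiny off
the region where `∑ |x n|` is large and the weight is near 1. These remain admissible at late
stages, so the terms `y n` cannot become small: a contradiction. -/

/-! ### Weak nullity and convex combinations -/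

section Mazur

open MeasureTheory Filter Topology CompactlySupported

/-- A positive functional on `C(K)` tends to zero along bounded pointwise null sequences. -/
theorem tendsto_positive_functional_of_pointwise {K : Type*} [MetricSpace K] [CompactSpace K]
    (L : C(K, ℝ) →L[ℝ] ℝ) (hL : ∀ f : C(K, ℝ), 0 ≤ f → 0 ≤ L f)
    (h : ℕ → C(K, ℝ)) (M : ℝ) (hM : ∀ n k, |h n k| ≤ M)
    (h0 : ∀ k, Tendsto (fun n => h n k) atTop (𝓝 0)) :
    Tendsto (fun n => L (h n)) atTop (𝓝 0) := by
  borelize K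
  -- By the Riesz representation theorem `L` is integration against a finite measure, so dominated
  -- convergence applies.
  let Λ : C_c(K, ℝ) →ₚ[ℝ] ℝ := PositiveLinearMap.mk₀
    { toFun := fun f => L f.toContinuousMap
      map_add' := fun f g => by
        rw [← map_add]; rfl
      map_smul' := fun c f => by
        rw [RingHom.id_apply, ← map_smul]; rfl }
    (fun f hf => hL _ fun k => hf k)
  have key : ∀ n, L (h n) = ∫ k, h n k ∂(RealRMK.rieszMeasure Λ) := fun n =>
    (RealRMK.integral_rieszMeasure Λ (CompactlySupportedContinuousMap.continuousMapEquiv (h n))).symm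
  simp_rw [key]
  have := tendsto_integral_of_dominated_convergence (μ := RealRMK.rieszMeasure Λ)
    (F := fun n k => h n k) (f := fun _ => (0 : ℝ)) (fun _ => M)
    (fun n => (h n).continuous.aestronglyMeasurable) (integrable_const M)
    (fun n => Eventually.of_forall fun k => hM n k) (Eventually.of_forall h0)
  simpa using this

/-- Mazur's theorem for bounded pointwise null sequences in `C(K)`, with absolute values inside the
convex combination. -/
theorem exists_convexCombination_abs_le {K : Type*} [MetricSpace K] [CompactSpace K]
    (d : ℕ → C(K, ℝ)) (M : ℝ) (hM : ∀ n k, |d n k| ≤ M)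
    (h0 : ∀ k, Tendsto (fun n => d n k) atTop (𝓝 0)) (ε : ℝ) (hε : 0 < ε) :
    ∃ (t : Finset ℕ) (w : ℕ → ℝ), (∀ i ∈ t, 0 ≤ w i) ∧ ∑ i ∈ t, w i = 1 ∧
      ∀ k, ∑ i ∈ t, w i * |d i k| ≤ ε := by
  -- If the convex hull of the `|d i|` misses `U`, Hahn–Banach separates the two. As `U` is closed
  -- under decreasing a function, the separating functional is positive.
  let U : Set C(K, ℝ) := {f | ∀ k, f k < ε}
  have hUo : IsOpen U := by
    have := ContinuousMap.isOpen_setOfPred_mapsTo (X := K) (Y := ℝ) (isCompact_univ) (isOpen_Iio (a := ε))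
    convert this using 1
    ext f
    simp [U, Set.MapsTo]
  have hUc : Convex ℝ U := by
    intro f hf g hg a b ha hb hab k
    exact (convex_Iio ε) (hf k) (hg k) ha hb hab
  by_contra hcon
  have hdisj : Disjoint U (convexHull ℝ (Set.range fun i => |d i|)) := by
    rw [Set.disjoint_left]
    intro f hfU hf
    rw [convexHull_range_eq_exists_affineCombination] at hf
    obtain ⟨t, w, hw, hw1, rfl⟩ := hf
    refine hcon ⟨t, w, hw, hw1, fun k => ?_⟩
    have := hfU k
    rw [Finset.affineCombination_eq_linear_combination _ _ _ hw1] at this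
    simpa [ContinuousMap.sum_apply] using this.le
  obtain ⟨L, u, hLU, hLd⟩ := geometric_hahn_banach_open hUc hUo (convex_convexHull ℝ _) hdisj
  have hu : 0 < u := by simpa using hLU 0 fun k => by simpa using hε
  have hL : ∀ f : C(K, ℝ), 0 ≤ f → 0 ≤ L f := by
    intro f hf
    by_contra hneg
    push Not at hneg
    -- This nonpositive multiple of `f` lies in `U`, but `L` takes the forbidden value `u` on it.
    have := hLU ((u / L f) • f) fun k => by
      have h1 : u / L f ≤ 0 := div_nonpos_of_nonneg_of_nonpos hu.le hneg.le
      have h2 : (u / L f) * f k ≤ 0 := mul_nonpos_of_nonpos_of_nonneg h1 (hf k)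
      simpa using h2.trans_lt hε
    rw [map_smul, smul_eq_mul, div_mul_cancel₀ _ hneg.ne] at this
    exact lt_irrefl _ this
  have hlim := tendsto_positive_functional_of_pointwise L hL (fun n => |d n|) M
    (fun n k => by simpa using hM n k) (fun k => by simpa using (h0 k).abs)
  exact absurd (ge_of_tendsto' hlim fun n => hLd _ (subset_convexHull ℝ _ ⟨n, rfl⟩)) (not_le.2 hu)

end Mazur

/-! ### Gliding humps and copies of `c₀` -/

section CZero

open Filter Topology

theorem ZeroAtInftyContinuousMap.abs_apply_le_norm (a : C₀(ℕ, ℝ)) (n : ℕ) : |a n| ≤ ‖a‖ := by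
  rw [← ZeroAtInftyContinuousMap.norm_toBCF_eq_norm]
  exact a.toBCF.norm_coe_le_norm n

theorem ZeroAtInftyContinuousMap.norm_le_of_abs_le (a : C₀(ℕ, ℝ)) {C : ℝ} (hC : 0 ≤ C)
    (h : ∀ n, |a n| ≤ C) : ‖a‖ ≤ C := by
  rw [← ZeroAtInftyContinuousMap.norm_toBCF_eq_norm]
  exact (BoundedContinuousFunction.norm_le hC).2 h

/-- If the sums `∑ |v j k|` are uniformly bounded, then `∑ a j • v j` converges in `C(K)` for every
null sequence `a`. -/
theorem summable_smul_of_sum_abs_le {K : Type*} [TopologicalSpace K] [CompactSpace K]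
    (v : ℕ → C(K, ℝ)) (M : ℝ) (hM : ∀ (t : Finset ℕ) k, ∑ j ∈ t, |v j k| ≤ M) (a : C₀(ℕ, ℝ)) :
    Summable fun j => a j • v j := by
  rw [summable_iff_vanishing_norm]
  intro ε hε
  have hM' : 0 < |M| + 1 := by positivity
  have hδ : 0 < ε / (2 * (|M| + 1)) := by positivity
  have ha : Tendsto a cofinite (𝓝 0) := by
    have := a.zero_at_infty'
    rwa [Filter.cocompact_eq_cofinite] at this
  have hfin : ∀ᶠ j in cofinite, |a j| < ε / (2 * (|M| + 1)) := by
    have := ha.abs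
    rw [abs_zero] at this
    exact this.eventually (gt_mem_nhds hδ)
  rw [eventually_cofinite] at hfin
  refine ⟨hfin.toFinset, fun t ht => ?_⟩
  have hle : ‖∑ j ∈ t, a j • v j‖ ≤ ε / 2 := by
    rw [ContinuousMap.norm_le _ (by positivity)]
    intro k
    rw [ContinuousMap.sum_apply, Real.norm_eq_abs]
    calc |∑ j ∈ t, (a j • v j) k| ≤ ∑ j ∈ t, |(a j • v j) k| := Finset.abs_sum_le_sum_abs _ _
      _ ≤ ∑ j ∈ t, ε / (2 * (|M| + 1)) * |v j k| := by
        refine Finset.sum_le_sum fun j hj => ?_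
        rw [ContinuousMap.smul_apply, smul_eq_mul, abs_mul]
        have hj' : j ∉ hfin.toFinset := Finset.disjoint_left.1 ht hj
        have : |a j| < ε / (2 * (|M| + 1)) := by simpa using hj'
        gcongr
      _ = ε / (2 * (|M| + 1)) * ∑ j ∈ t, |v j k| := by rw [Finset.mul_sum]
      _ ≤ ε / (2 * (|M| + 1)) * (|M| + 1) := by
        have := (hM t k).trans (le_abs_self M)
        gcongr
        linarith
      _ = ε / 2 := by field_simp
  linarith

/-- A linear map that is bounded above and below is an embedding. -/
theorem embedsInto_of_linearMap {Y X : Type*} [NormedAddCommGroup Y] [NormedSpace ℝ Y]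
    [NormedAddCommGroup X] [NormedSpace ℝ X] (T : Y →ₗ[ℝ] X) (M c : ℝ) (hc : 0 < c)
    (hup : ∀ a, ‖T a‖ ≤ M * ‖a‖) (hlow : ∀ a, c * ‖a‖ ≤ ‖T a‖) : EmbedsInto Y X := by
  have hinj : Function.Injective T := by
    rw [injective_iff_map_eq_zero]
    intro a ha
    have := hlow a
    rw [ha, norm_zero] at this
    exact norm_le_zero_iff.1 (nonpos_of_mul_nonpos_right this hc)
  refine ⟨LinearMap.range T, ⟨(LinearEquiv.ofInjective T hinj).toContinuousLinearEquivOfBounds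
    M c⁻¹ (fun a => hup a) fun b => ?_⟩⟩
  obtain ⟨a, rfl⟩ := (LinearEquiv.ofInjective T hinj).surjective b
  rw [LinearEquiv.symm_apply_apply, inv_mul_eq_div, le_div_iff₀ hc, mul_comm]
  exact hlow a

/-- A sequence in `C(K)` with uniformly bounded sums `∑ |v j k|` that is nearly biorthogonal to a
sequence of point evaluations spans a copy of `c₀`. -/
theorem embedsInto_of_almost_biorthogonal {K : Type*} [TopologicalSpace K] [CompactSpace K]
    (X : Submodule ℝ C(K, ℝ)) (hX : IsClosed (X : Set C(K, ℝ))) (v : ℕ → C(K, ℝ))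
    (hv : ∀ j, v j ∈ X) (M : ℝ) (hM : ∀ (t : Finset ℕ) k, ∑ j ∈ t, |v j k| ≤ M)
    (c : ℝ) (hc : 0 < c) (p : ℕ → K) (hdiag : ∀ n, 2 * c ≤ |v n (p n)|)
    (hoff : ∀ n (t : Finset ℕ), n ∉ t → ∑ j ∈ t, |v j (p n)| ≤ c) :
    EmbedsInto C₀(ℕ, ℝ) X := by
  have hsum := summable_smul_of_sum_abs_le v M hM
  have hmem : ∀ a : C₀(ℕ, ℝ), ∑' j, a j • v j ∈ X := fun a =>
    hX.mem_of_tendsto (hsum a).hasSum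
      (Eventually.of_forall fun t => X.sum_mem fun j _ => X.smul_mem _ (hv j))
  have hpt : ∀ (a : C₀(ℕ, ℝ)) k, HasSum (fun j => a j * v j k) ((∑' j, a j • v j) k) :=
    fun a k => by
      simpa using (ContinuousMap.evalCLM ℝ k : C(K, ℝ) →L[ℝ] ℝ).hasSum (hsum a).hasSum
  have hM0 : 0 ≤ M := by simpa using hM ∅ (p 0)
  let T : C₀(ℕ, ℝ) →ₗ[ℝ] X :=
    { toFun := fun a => ⟨∑' j, a j • v j, hmem a⟩
      map_add' := fun a b => by
        ext1
        simp only [ZeroAtInftyContinuousMap.coe_add, Pi.add_apply, add_smul, Submodule.coe_add]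
        exact (hsum a).tsum_add (hsum b)
      map_smul' := fun r a => by
        ext1
        simp only [ZeroAtInftyContinuousMap.coe_smul, Pi.smul_apply, smul_assoc,
          Submodule.coe_smul, RingHom.id_apply]
        exact (hsum a).tsum_const_smul r }
  have hup : ∀ a, ‖T a‖ ≤ M * ‖a‖ := by
    intro a
    change ‖∑' j, a j • v j‖ ≤ _
    rw [ContinuousMap.norm_le _ (by positivity)]
    intro k
    refine le_of_tendsto (hpt a k).norm (Eventually.of_forall fun t => ?_)
    calc ‖∑ j ∈ t, a j * v j k‖ ≤ ∑ j ∈ t, ‖a j * v j k‖ := norm_sum_le _ _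
      _ ≤ ∑ j ∈ t, ‖a‖ * |v j k| := by
        refine Finset.sum_le_sum fun j _ => ?_
        rw [Real.norm_eq_abs, abs_mul]
        gcongr
        exact a.abs_apply_le_norm j
      _ = (∑ j ∈ t, |v j k|) * ‖a‖ := by rw [← Finset.mul_sum, mul_comm]
      _ ≤ M * ‖a‖ := by gcongr; exact hM t k
  have hlow : ∀ a, c * ‖a‖ ≤ ‖T a‖ := by
    intro a
    -- At `p n` the diagonal term has size at least `2 * c * |a n|`, and all others together at most
    -- `c * ‖a‖`. The supremum over `n` gives the lower bound.
    have h1 : ∀ n, 2 * c * |a n| ≤ ‖T a‖ + c * ‖a‖ := by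
      intro n
      have h2 : ‖a n * v n (p n)‖ - c * ‖a‖ ≤ ‖(∑' j, a j • v j) (p n)‖ := by
        refine ge_of_tendsto (hpt a (p n)).norm ?_
        filter_upwards [eventually_ge_atTop {n}] with t ht
        have hn : n ∈ t := ht (Finset.mem_singleton_self n)
        rw [← Finset.add_sum_erase _ _ hn]
        have h3 : ‖∑ j ∈ t.erase n, a j * v j (p n)‖ ≤ c * ‖a‖ := by
          calc ‖∑ j ∈ t.erase n, a j * v j (p n)‖ ≤ ∑ j ∈ t.erase n, ‖a j * v j (p n)‖ :=
                norm_sum_le _ _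
            _ ≤ ∑ j ∈ t.erase n, ‖a‖ * |v j (p n)| := by
              refine Finset.sum_le_sum fun j _ => ?_
              rw [Real.norm_eq_abs, abs_mul]
              gcongr
              exact a.abs_apply_le_norm j
            _ = (∑ j ∈ t.erase n, |v j (p n)|) * ‖a‖ := by rw [← Finset.mul_sum, mul_comm]
            _ ≤ c * ‖a‖ := by
              gcongr
              exact hoff n _ (Finset.notMem_erase n t)
        have h4 := norm_sub_le (a n * v n (p n) + ∑ j ∈ t.erase n, a j * v j (p n))
          (∑ j ∈ t.erase n, a j * v j (p n))
        rw [add_sub_cancel_right] at h4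
        linarith
      have h5 : ‖(∑' j, a j • v j) (p n)‖ ≤ ‖T a‖ := ContinuousMap.norm_coe_le_norm _ _
      have h6 : 2 * c * |a n| ≤ ‖a n * v n (p n)‖ := by
        rw [Real.norm_eq_abs, abs_mul, mul_comm]
        gcongr
        exact hdiag n
      linarith
    have h2 : ‖a‖ ≤ (‖T a‖ + c * ‖a‖) / (2 * c) :=
      a.norm_le_of_abs_le (by positivity) fun n => by
        rw [le_div_iff₀ (by positivity), mul_comm]; exact h1 n
    rw [le_div_iff₀ (by positivity)] at h2
    linarith
  exact embedsInto_of_linearMap T M c hc hup hlow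

/-- A sequence in `C(K)` that is bounded away from zero and has uniformly bounded sums `∑ |u j k|`
has a subsequence that spans a copy of `c₀`. -/
theorem embedsInto_of_sum_abs_le {K : Type*} [MetricSpace K] [CompactSpace K]
    (X : Submodule ℝ C(K, ℝ)) (hX : IsClosed (X : Set C(K, ℝ))) (u : ℕ → C(K, ℝ))
    (hu : ∀ j, u j ∈ X) (M : ℝ) (hM : ∀ (t : Finset ℕ) k, ∑ j ∈ t, |u j k| ≤ M)
    (ε : ℝ) (hε : 0 < ε) (q : ℕ → K) (hq : ∀ n, ε ≤ |u n (q n)|) :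
    EmbedsInto C₀(ℕ, ℝ) X := by
  wlog hconv : ∃ z, Tendsto q atTop (𝓝 z) generalizing u q
  · obtain ⟨z, φ, hφ, hz⟩ := CompactSpace.tendsto_subseq q
    refine this (u ∘ φ) (fun j => hu _) (fun t k => ?_) (q ∘ φ) (fun n => hq _) ⟨z, hz⟩
    have := hM (t.map ⟨φ, hφ.injective⟩) k
    rwa [Finset.sum_map] at this
  obtain ⟨z, hz⟩ := hconv
  have hsumm : ∀ k, Summable fun j => |u j k| := fun k =>
    summable_of_sum_le (fun _ => abs_nonneg _) (hM · k)
  have htail : ∀ k, ∃ J, ∀ t : Finset ℕ, (∀ j ∈ t, J ≤ j) → ∑ j ∈ t, |u j k| < ε / 8 := by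
    intro k
    obtain ⟨s, hs⟩ := summable_iff_vanishing_norm.1 (hsumm k) (ε / 8) (by positivity)
    refine ⟨s.sup id + 1, fun t ht => ?_⟩
    refine (le_abs_self _).trans_lt (hs t (Finset.disjoint_left.2 fun j hj hjs => ?_))
    have h1 := ht j hj
    have h2 : j ≤ s.sup id := Finset.le_sup (f := id) hjs
    omega
  -- Gliding hump: from `i'` on, the functions up to index `i` take nearly their values at `z` on
  -- the points `q m`, and the later functions are negligible at `q i`.
  have hnext : ∀ i, ∃ i', i < i' ∧
      (∀ m, i' ≤ m → ∑ l ∈ Finset.range (i + 1), |u l (q m) - u l z| < ε / 8) ∧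
      ∀ t : Finset ℕ, (∀ j ∈ t, i' ≤ j) → ∑ j ∈ t, |u j (q i)| < ε / 8 := by
    intro i
    have h1 : Tendsto (fun m => ∑ l ∈ Finset.range (i + 1), |u l (q m) - u l z|) atTop (𝓝 0) := by
      rw [show (0 : ℝ) = ∑ l ∈ Finset.range (i + 1), |u l z - u l z| by simp]
      exact tendsto_finsetSum _ fun l _ =>
        ((((u l).continuous.tendsto z).comp hz).sub_const _).abs
    obtain ⟨m, hm⟩ := eventually_atTop.1 (h1.eventually (gt_mem_nhds (by positivity : 0 < ε / 8)))
    obtain ⟨J, hJ⟩ := htail (q i)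
    exact ⟨max (i + 1) (max m J), by omega, fun m' hm' => hm m' (by omega),
      fun t ht => hJ t fun j hj => by have := ht j hj; omega⟩
  choose ν hν1 hν2 hν3 using hnext
  -- Starting at `J` keeps the selected functions small at `z`. At `q (ι n)` the earlier ones then
  -- contribute at most `ε / 8 + ε / 8` and the later ones `ε / 8`, within the allowed `ε / 2`.
  obtain ⟨J, hJ⟩ := htail z
  let ι : ℕ → ℕ := fun n => Nat.rec J (fun _ i => ν i) n
  have hι : ∀ n, ι (n + 1) = ν (ι n) := fun n => rfl
  have hmono : StrictMono ι := strictMono_nat_of_lt_succ fun n => hν1 (ι n)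
  have hJι : ∀ n, J ≤ ι n := fun n => hmono.monotone (Nat.zero_le n)
  have hbefore : ∀ n (t : Finset ℕ), (∀ j ∈ t, j < n) → ∑ j ∈ t, |u (ι j) (q (ι n))| ≤ ε / 4 := by
    intro n t ht
    have h1 : ∑ j ∈ t, |u (ι j) z| < ε / 8 := by
      have := hJ (t.map ⟨ι, hmono.injective⟩) (by simpa using fun j _ => hJι j)
      rwa [Finset.sum_map] at this
    have h2 : ∑ j ∈ t, |u (ι j) (q (ι n)) - u (ι j) z| ≤ ε / 8 := by
      cases n with
      | zero =>
        have : t = ∅ := Finset.eq_empty_of_forall_notMem fun j hj => by simpa using ht j hj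
        subst this
        simp only [Finset.sum_empty]
        positivity
      | succ n =>
        refine le_trans ?_ (hν2 (ι n) (ι (n + 1)) le_rfl).le
        have := Finset.sum_le_sum_of_subset_of_nonneg
          (f := fun l => |u l (q (ι (n + 1))) - u l z|)
          (s := t.map ⟨ι, hmono.injective⟩) (t := Finset.range (ι n + 1)) (by
            intro l hl
            obtain ⟨j, hj, rfl⟩ := Finset.mem_map.1 hl
            have := hmono.monotone (Nat.lt_succ_iff.1 (ht j hj))
            exact Finset.mem_range.2 (Nat.lt_succ_of_le this)) fun _ _ _ => abs_nonneg _
        rwa [Finset.sum_map] at this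
    calc ∑ j ∈ t, |u (ι j) (q (ι n))|
        ≤ ∑ j ∈ t, (|u (ι j) z| + |u (ι j) (q (ι n)) - u (ι j) z|) := by
          refine Finset.sum_le_sum fun j _ => ?_
          have := abs_add_le (u (ι j) z) (u (ι j) (q (ι n)) - u (ι j) z)
          rwa [add_sub_cancel] at this
      _ ≤ ε / 4 := by rw [Finset.sum_add_distrib]; linarith
  have hafter : ∀ n (t : Finset ℕ), (∀ j ∈ t, n < j) → ∑ j ∈ t, |u (ι j) (q (ι n))| ≤ ε / 8 := by
    intro n t ht
    have := hν3 (ι n) (t.map ⟨ι, hmono.injective⟩) (by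
      intro l hl
      obtain ⟨j, hj, rfl⟩ := Finset.mem_map.1 hl
      exact hmono.monotone (Nat.succ_le_of_lt (ht j hj)))
    rw [Finset.sum_map] at this
    exact this.le
  refine embedsInto_of_almost_biorthogonal X hX (u ∘ ι) (fun j => hu _) M (fun t k => ?_)
    (ε / 2) (by positivity) (q ∘ ι) (fun n => ?_) fun n t hn => ?_
  · have := hM (t.map ⟨ι, hmono.injective⟩) k
    rwa [Finset.sum_map] at this
  · have := hq (ι n)
    simp only [Function.comp]
    linarith
  · rw [← Finset.sum_filter_add_sum_filter_not t (· < n)]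
    have h1 := hbefore n (t.filter (· < n)) (by simp)
    have h2 := hafter n (t.filter (¬ · < n)) fun j hj => by
      rw [Finset.mem_filter] at hj
      exact lt_of_le_of_ne (not_lt.1 hj.2) fun h => hn (h ▸ hj.1)
    simp only [Function.comp]
    linarith

/-- If the sums `∑ |y i k|` are uniformly bounded but do not converge uniformly, then the closed
span of `(y i)` contains a copy of `c₀`. -/
theorem embedsInto_of_not_uniform {K : Type*} [MetricSpace K] [CompactSpace K]
    (X : Submodule ℝ C(K, ℝ)) (hX : IsClosed (X : Set C(K, ℝ))) (y : ℕ → C(K, ℝ))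
    (hy : ∀ j, y j ∈ X) (M : ℝ) (hM : ∀ (t : Finset ℕ) k, ∑ j ∈ t, |y j k| ≤ M)
    (ε : ℝ) (hε : 0 < ε) (h : ∀ m, ∃ n k, ε ≤ ∑ j ∈ Finset.Ico m n, |y j k|) :
    EmbedsInto C₀(ℕ, ℝ) X := by
  choose ν q hq using h
  have hlt : ∀ m, m < ν m := by
    intro m
    by_contra hcon
    have := hq m
    rw [Finset.Ico_eq_empty_of_le (not_lt.1 hcon), Finset.sum_empty] at this
    linarith
  let ι : ℕ → ℕ := fun n => Nat.rec 0 (fun _ i => ν i) n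
  have hmono : StrictMono ι := strictMono_nat_of_lt_succ fun n => hlt (ι n)
  -- With these signs the block `u n` attains the full absolute sum at `q (ι n)`.
  let σ : ℕ → ℕ → ℝ := fun n j => (SignType.sign (y j (q (ι n))) : ℝ)
  have hσ : ∀ n j, |σ n j| ≤ 1 := by
    intro n j
    simp only [σ]
    rcases lt_trichotomy (y j (q (ι n))) 0 with h | h | h <;> simp [h]
  let u : ℕ → C(K, ℝ) := fun n => ∑ j ∈ Finset.Ico (ι n) (ι (n + 1)), σ n j • y j
  have hule : ∀ n k, |u n k| ≤ ∑ j ∈ Finset.Ico (ι n) (ι (n + 1)), |y j k| := by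
    intro n k
    simp only [u, ContinuousMap.sum_apply]
    refine (Finset.abs_sum_le_sum_abs _ _).trans (Finset.sum_le_sum fun j _ => ?_)
    rw [ContinuousMap.smul_apply, smul_eq_mul, abs_mul]
    exact mul_le_of_le_one_left (abs_nonneg _) (hσ n j)
  refine embedsInto_of_sum_abs_le X hX u (fun n => X.sum_mem fun j _ => X.smul_mem _ (hy j)) M
    (fun t k => ?_) ε hε (q ∘ ι) fun n => ?_
  · calc ∑ n ∈ t, |u n k| ≤ ∑ n ∈ Finset.range (t.sup id + 1), |u n k| :=
          Finset.sum_le_sum_of_subset_of_nonneg (fun j hj => Finset.mem_range.2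
            (Nat.lt_succ_of_le (Finset.le_sup (f := id) hj))) fun _ _ _ => abs_nonneg _
      _ ≤ ∑ n ∈ Finset.range (t.sup id + 1), ∑ j ∈ Finset.Ico (ι n) (ι (n + 1)), |y j k| :=
          Finset.sum_le_sum fun n _ => hule n k
      _ = ∑ j ∈ Finset.Ico (ι 0) (ι (t.sup id + 1)), |y j k| := by
          generalize t.sup id + 1 = N
          induction N with
          | zero => simp
          | succ N ih =>
            rw [Finset.sum_range_succ, ih, Finset.sum_Ico_consecutive _
              (hmono.monotone (Nat.zero_le _)) (hmono.monotone (Nat.le_succ _))]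
      _ ≤ M := hM _ k
  · have : u n (q (ι n)) = ∑ j ∈ Finset.Ico (ι n) (ι (n + 1)), |y j (q (ι n))| := by
      simp only [u, ContinuousMap.sum_apply]
      refine Finset.sum_congr rfl fun j _ => ?_
      rw [ContinuousMap.smul_apply, smul_eq_mul]
      exact sign_mul_self _
    simp only [Function.comp]
    rw [this]
    exact (hq (ι n)).trans (le_abs_self _)

end CZero

/-! ### Convex blocks of finite variation -/

section Blocks

open Filter Topology

theorem abs_sum_mul_sub_le {t : Finset ℕ} {w a : ℕ → ℝ} {c R : ℝ} (hw : ∀ i ∈ t, 0 ≤ w i)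
    (hw1 : ∑ i ∈ t, w i = 1) (ha : ∀ i ∈ t, |a i - c| ≤ R) : |∑ i ∈ t, w i * a i - c| ≤ R := by
  have h1 : ∑ i ∈ t, w i * a i - c = ∑ i ∈ t, w i * (a i - c) := by
    simp_rw [mul_sub]
    rw [Finset.sum_sub_distrib, ← Finset.sum_mul, hw1, one_mul]
  rw [h1]
  calc |∑ i ∈ t, w i * (a i - c)| ≤ ∑ i ∈ t, |w i * (a i - c)| := Finset.abs_sum_le_sum_abs _ _
    _ ≤ ∑ i ∈ t, w i * R := by
      refine Finset.sum_le_sum fun i hi => ?_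
      rw [abs_mul, abs_of_nonneg (hw i hi)]
      exact mul_le_mul_of_nonneg_left (ha i hi) (hw i hi)
    _ = R := by rw [← Finset.sum_mul, hw1, one_mul]

theorem abs_sub_le_sum_Ico (a : ℕ → ℝ) {m n : ℕ} (h : m ≤ n) :
    |a n - a m| ≤ ∑ i ∈ Finset.Ico m n, |a (i + 1) - a i| := by
  rw [← Finset.sum_Ico_sub a h]
  exact Finset.abs_sum_le_sum_abs _ _

/-- If `F ∈ DSC K` is the pointwise limit of the bounded sequence `g`, then suitable convex blocks
of `g` converge to `F` with pointwise finite variation. -/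
theorem exists_blocks_summable {K : Type*} [MetricSpace K] [CompactSpace K] {F : K → ℝ}
    (hF : F ∈ DSC K) {g : ℕ → C(K, ℝ)} (hg : BoundedlyConvergesTo g F) :
    ∃ G : ℕ → C(K, ℝ), (∀ j, G j ∈ Submodule.span ℝ (Set.range g)) ∧
      (∀ k, Summable fun j => |G (j + 1) k - G j k|) ∧
      ∀ k, Tendsto (fun j => G j k) atTop (𝓝 (F k)) := by
  obtain ⟨f, ⟨⟨A, hA⟩, hfF⟩, hfs⟩ := hF
  obtain ⟨⟨B, hB⟩, hgF⟩ := hg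
  have hmazur : ∀ (N j : ℕ), ∃ (t : Finset ℕ) (w : ℕ → ℝ), (∀ i ∈ t, 0 ≤ w i) ∧
      ∑ i ∈ t, w i = 1 ∧ ∀ k, ∑ i ∈ t, w i * |(f (N + i) - g (N + i)) k| ≤ (1 / 2 : ℝ) ^ j := by
    intro N j
    refine exists_convexCombination_abs_le (fun i => f (N + i) - g (N + i)) (A + B)
      (fun n k => ?_) (fun k => ?_) _ (by positivity)
    · exact (abs_sub _ _).trans (add_le_add (hA _ k) (hB _ k))
    · have h1 := (hfF k).sub (hgF k)
      rw [sub_self] at h1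
      have h2 : Tendsto (fun n => N + n) atTop atTop :=
        tendsto_atTop_mono (Nat.le_add_left · N) tendsto_id
      exact h1.comp h2
  choose t w hw0 hw1 hwd using hmazur
  -- Block `j` uses only indices in `[N j, N (j + 1)]`, so the variations `D j` of `f` over these
  -- intervals add up to at most its total variation.
  let N : ℕ → ℕ := fun j => Nat.rec 0 (fun j n => n + (t n j).sup id + 1) j
  have hN : ∀ j, N (j + 1) = N j + (t (N j) j).sup id + 1 := fun j => rfl
  have hmono : StrictMono N := strictMono_nat_of_lt_succ fun j => by rw [hN]; omega
  have ht : ∀ j, ∀ i ∈ t (N j) j, N j + i ≤ N (j + 1) := by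
    intro j i hi
    have : i ≤ (t (N j) j).sup id := Finset.le_sup (f := id) hi
    rw [hN]
    omega
  let G : ℕ → C(K, ℝ) := fun j => ∑ i ∈ t (N j) j, w (N j) j i • g (N j + i)
  have hG : ∀ j k, G j k = ∑ i ∈ t (N j) j, w (N j) j i * g (N j + i) k := by
    intro j k
    simp [G, ContinuousMap.sum_apply]
  refine ⟨G, fun j => Submodule.sum_mem _ fun i _ =>
    Submodule.smul_mem _ _ (Submodule.subset_span ⟨_, rfl⟩), fun k => ?_, fun k => ?_⟩
  · let D : ℕ → ℝ := fun j => ∑ i ∈ Finset.Ico (N j) (N (j + 1)), |f (i + 1) k - f i k|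
    have hD0 : ∀ j, 0 ≤ D j := fun j => Finset.sum_nonneg fun _ _ => abs_nonneg _
    have hDle : ∀ j n, N j ≤ n → n ≤ N (j + 1) → |f n k - f (N j) k| ≤ D j := by
      intro j n h1 h2
      refine (abs_sub_le_sum_Ico (fun n => f n k) h1).trans ?_
      exact Finset.sum_le_sum_of_subset_of_nonneg (Finset.Ico_subset_Ico_right h2)
        fun _ _ _ => abs_nonneg _
    have hDs : Summable D := by
      refine summable_of_sum_range_le hD0 (c := ∑' i, |f (i + 1) k - f i k|) fun n => ?_
      have : ∑ j ∈ Finset.range n, D j = ∑ i ∈ Finset.Ico (N 0) (N n), |f (i + 1) k - f i k| := by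
        induction n with
        | zero => simp
        | succ n ih =>
          rw [Finset.sum_range_succ, ih, Finset.sum_Ico_consecutive _
            (hmono.monotone (Nat.zero_le _)) (hmono.monotone (Nat.le_succ _))]
      rw [this]
      exact (hfs k).sum_le_tsum _ fun _ _ => abs_nonneg _
    have hGf : ∀ j, |G j k - f (N j) k| ≤ D j + (1 / 2 : ℝ) ^ j := by
      intro j
      have h1 : |∑ i ∈ t (N j) j, w (N j) j i * f (N j + i) k - f (N j) k| ≤ D j :=
        abs_sum_mul_sub_le (hw0 _ _) (hw1 _ _) fun i hi =>
          hDle j _ (Nat.le_add_right _ _) (ht j i hi)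
      have h2 : |∑ i ∈ t (N j) j, w (N j) j i * f (N j + i) k - G j k| ≤ (1 / 2 : ℝ) ^ j := by
        rw [hG, ← Finset.sum_sub_distrib]
        refine ((Finset.abs_sum_le_sum_abs _ _).trans (le_of_eq ?_)).trans (hwd (N j) j k)
        refine Finset.sum_congr rfl fun i hi => ?_
        rw [← mul_sub, abs_mul, abs_of_nonneg (hw0 _ _ i hi)]
        rfl
      rw [abs_le] at *
      constructor <;> linarith [h1.1, h1.2, h2.1, h2.2]
    have hgeo : Summable fun j : ℕ => (1 / 2 : ℝ) ^ j := summable_geometric_two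
    -- Compare `G j` with `G (j + 1)` through `f (N j)` and `f (N (j + 1))`.
    refine Summable.of_nonneg_of_le (fun _ => abs_nonneg _) (fun j => ?_)
      (((hDs.add hgeo).add hDs).add ((summable_nat_add_iff 1).2 (hDs.add hgeo)))
    have h1 := hGf j
    have h2 := hGf (j + 1)
    have h3 := hDle j (N (j + 1)) (hmono.monotone (Nat.le_succ j)) le_rfl
    rw [abs_le] at *
    constructor <;> linarith [h1.1, h1.2, h2.1, h2.2, h3.1, h3.2]
  · rw [Metric.tendsto_atTop]
    intro ε hε
    obtain ⟨n, hn⟩ := Metric.tendsto_atTop.1 (hgF k) (ε / 2) (by positivity)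
    refine ⟨n, fun j hj => ?_⟩
    rw [Real.dist_eq, hG]
    refine (abs_sum_mul_sub_le (R := ε / 2) (hw0 _ _) (hw1 _ _) fun i _ => ?_).trans_lt
      (by linarith)
    have := hn (N j + i) (by have := hmono.id_le j; simp only [id] at this; omega)
    rw [Real.dist_eq] at this
    exact this.le

end Blocks

/-! ### Pointwise absolutely summable series with discontinuous sum -/

section PointwiseSummable

open Filter Topology

theorem continuous_tsum_of_uniform_tails {K : Type*} [TopologicalSpace K] (y : ℕ → C(K, ℝ))
    (hs : ∀ k, Summable fun n => |y n k|)
    (h : ∀ ε : ℝ, 0 < ε → ∃ m, ∀ n k, ∑ j ∈ Finset.Ico m n, |y j k| < ε) :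
    Continuous fun k => ∑' n, y n k := by
  have hu : TendstoUniformly (fun n k => ∑ j ∈ Finset.range n, y j k) (fun k => ∑' n, y n k)
      atTop := by
    rw [Metric.tendstoUniformly_iff]
    intro ε hε
    obtain ⟨m, hm⟩ := h (ε / 2) (by positivity)
    filter_upwards [eventually_ge_atTop m] with n hn k
    have h1 := (((hs k).of_abs.hasSum.tendsto_sum_nat).sub_const (∑ j ∈ Finset.range n, y j k)).abs
    refine lt_of_le_of_lt (le_of_tendsto h1 ?_) (half_lt_self hε)
    filter_upwards [eventually_ge_atTop n] with N hN
    rw [← Finset.sum_Ico_eq_sub _ hN]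
    refine (Finset.abs_sum_le_sum_abs _ _).trans (le_trans ?_ (hm N k).le)
    exact Finset.sum_le_sum_of_subset_of_nonneg (Finset.Ico_subset_Ico_left hn)
      fun _ _ _ => abs_nonneg _
  refine hu.continuous (Frequently.of_forall fun n => ?_)
  exact continuous_finsetSum _ fun j _ => (y j).continuous

/-- If a series in `X` is pointwise absolutely summable with discontinuous sum, and every series in
`X` with bounded absolute sums has uniformly small tails, then `X` contains functions of
given norm that are small where the variation of the series is small. -/
theorem exists_norm_eq_of_not_continuous {K : Type*} [TopologicalSpace K] [CompactSpace K]
    (X : Submodule ℝ C(K, ℝ))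
    (hU : ∀ y : ℕ → C(K, ℝ), (∀ j, y j ∈ X) → ∀ M : ℝ,
      (∀ (t : Finset ℕ) k, ∑ j ∈ t, |y j k| ≤ M) →
      ∀ ε : ℝ, 0 < ε → ∃ m, ∀ n k, ∑ j ∈ Finset.Ico m n, |y j k| < ε)
    (x : ℕ → C(K, ℝ)) (hx : ∀ j, x j ∈ X) (hs : ∀ k, Summable fun n => |x n k|)
    (hF : ¬ Continuous fun k => ∑' n, x n k) (T η δ : ℝ) (hη : 0 < η) (hδ : 0 < δ) :
    ∃ y ∈ X, ‖y‖ = δ ∧ ∀ k, ∑' n, |x n k| ≤ T → |y k| ≤ η := by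
  by_contra! hcon
  -- Otherwise norms on `X` are controlled by values on the set where the variation is at most `T`.
  -- Signed partial sums of `x` are bounded by `|T|` there, hence bounded on all of `K`, which makes
  -- the sum continuous.
  refine hF (continuous_tsum_of_uniform_tails x hs (hU x hx (δ / η * |T|) fun t k => ?_))
  let z : C(K, ℝ) := ∑ j ∈ t, (SignType.sign (x j k) : ℝ) • x j
  have hz : z ∈ X := X.sum_mem fun j _ => X.smul_mem _ (hx j)
  have hzk : z k = ∑ j ∈ t, |x j k| := by
    simp only [z, ContinuousMap.sum_apply]
    exact Finset.sum_congr rfl fun j _ => sign_mul_self _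
  have hzle : ∀ k', ∑' n, |x n k'| ≤ T → |z k'| ≤ |T| := by
    intro k' hk'
    refine le_trans ?_ (hk'.trans (le_abs_self T))
    refine le_trans ?_ ((hs k').sum_le_tsum t fun _ _ => abs_nonneg _)
    simp only [z, ContinuousMap.sum_apply]
    refine (Finset.abs_sum_le_sum_abs _ _).trans (Finset.sum_le_sum fun j _ => ?_)
    rw [ContinuousMap.smul_apply, smul_eq_mul, abs_mul]
    refine mul_le_of_le_one_left (abs_nonneg _) ?_
    rcases lt_trichotomy (x j k) 0 with h | h | h <;> simp [h]
  have hzn : ‖z‖ ≤ δ / η * |T| := by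
    by_contra! hlt
    have hpos : 0 < ‖z‖ := lt_of_le_of_lt (by positivity) hlt
    obtain ⟨k', hk', hlt'⟩ := hcon ((δ / ‖z‖) • z) (X.smul_mem _ hz) (by
      rw [norm_smul, norm_div, norm_norm, Real.norm_of_nonneg hδ.le, div_mul_cancel₀ _ hpos.ne'])
    rw [ContinuousMap.smul_apply, smul_eq_mul, abs_mul, abs_of_pos (div_pos hδ hpos),
      div_mul_eq_mul_div, lt_div_iff₀ hpos] at hlt'
    rw [div_mul_eq_mul_div, div_lt_iff₀ hη] at hlt
    have := mul_le_mul_of_nonneg_left (hzle k' hk') hδ.le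
    linarith
  rw [← hzk]
  exact (le_abs_self _).trans ((ContinuousMap.norm_coe_le_norm z k).trans hzn)

/-- An almost norm-maximal element among those `y ∈ X` with `w * (G + |y|) ≤ b`. -/
theorem exists_almost_maximal {K : Type*} [TopologicalSpace K] [CompactSpace K]
    (X : Submodule ℝ C(K, ℝ)) (w : K → ℝ) (hw : ∀ k, 1 ≤ w k) (G : C(K, ℝ)) (hG : ∀ k, 0 ≤ G k)
    (b : ℝ) (hb : ∀ k, w k * G k ≤ b) :
    ∃ y ∈ X, (∀ k, w k * (G k + |y k|) ≤ b) ∧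
      ∀ y' ∈ X, (∀ k, w k * (G k + |y' k|) ≤ b) → ‖y'‖ ≤ 2 * ‖y‖ := by
  let S : Set ℝ := {r | ∃ y ∈ X, (∀ k, w k * (G k + |y k|) ≤ b) ∧ ‖y‖ = r}
  have h0 : (0 : ℝ) ∈ S := ⟨0, X.zero_mem, by simpa using hb, norm_zero⟩
  have hbdd : BddAbove S := by
    refine ⟨|b|, ?_⟩
    rintro r ⟨y, -, hy, rfl⟩
    rw [ContinuousMap.norm_le _ (abs_nonneg b)]
    intro k
    have h1 : 1 * (G k + |y k|) ≤ w k * (G k + |y k|) :=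
      mul_le_mul_of_nonneg_right (hw k) (add_nonneg (hG k) (abs_nonneg _))
    rw [Real.norm_eq_abs]
    linarith [hy k, hG k, le_abs_self b]
  by_cases hpos : 0 < sSup S
  · obtain ⟨r, ⟨y, hyX, hy, rfl⟩, hlt⟩ := exists_lt_of_lt_csSup ⟨0, h0⟩ (half_lt_self hpos)
    refine ⟨y, hyX, hy, fun y' hX' hy' => ?_⟩
    have : ‖y'‖ ≤ sSup S := le_csSup hbdd ⟨y', hX', hy', rfl⟩
    linarith
  · refine ⟨0, X.zero_mem, by simpa using hb, fun y' hX' hy' => ?_⟩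
    have : ‖y'‖ ≤ sSup S := le_csSup hbdd ⟨y', hX', hy', rfl⟩
    rw [norm_zero]
    linarith

/-- A closed subspace of `C(K)` containing a pointwise absolutely summable series with discontinuous
sum contains a copy of `c₀`. -/
theorem embedsInto_of_pointwise_summable {K : Type*} [MetricSpace K] [CompactSpace K]
    (X : Submodule ℝ C(K, ℝ)) (hX : IsClosed (X : Set C(K, ℝ)))
    (x : ℕ → C(K, ℝ)) (hx : ∀ j, x j ∈ X) (hs : ∀ k, Summable fun n => |x n k|)
    (hF : ¬ Continuous fun k => ∑' n, x n k) : EmbedsInto C₀(ℕ, ℝ) X := by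
  by_contra hemb
  have hU : ∀ y : ℕ → C(K, ℝ), (∀ j, y j ∈ X) → ∀ M : ℝ,
      (∀ (t : Finset ℕ) k, ∑ j ∈ t, |y j k| ≤ M) →
      ∀ ε : ℝ, 0 < ε → ∃ m, ∀ n k, ∑ j ∈ Finset.Ico m n, |y j k| < ε := by
    intro y hy M hM ε hε
    by_contra! hcon
    exact hemb (embedsInto_of_not_uniform X hX y hy M hM ε hε hcon)
  let V : K → ℝ := fun k => ∑' n, |x n k|
  have hV : ∀ k, 0 ≤ V k := fun k => tsum_nonneg fun _ => abs_nonneg _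
  have hsmall := exists_norm_eq_of_not_continuous X hU x hx hs hF
  -- The weight is above 1 everywhere but close to 1 where the variation `V` is large.
  let w : K → ℝ := fun k => 1 + 1 / (1 + V k)
  have hw1 : ∀ k, 1 < w k := fun k => by
    have := hV k
    simp only [w, lt_add_iff_pos_right]
    positivity
  have hw2 : ∀ k, w k ≤ 2 := fun k => by
    have : 1 / (1 + V k) ≤ 1 := by
      rw [div_le_one (by linarith [hV k])]
      linarith [hV k]
    simp only [w]
    linarith
  -- The bounds increase to 1, and each stage opens a fresh slack of `(1 / 2) ^ (n + 1)`.
  let b : ℕ → ℝ := fun n => 1 - (1 / 2) ^ n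
  have hbsucc : ∀ n, b (n + 1) = b n + (1 / 2) ^ (n + 1) := fun n => by
    simp only [b, pow_succ]
    ring
  have hstep : ∀ (n : ℕ) (G : C(K, ℝ)), ∃ y ∈ X, (∀ k, 0 ≤ G k) → (∀ k, w k * G k ≤ b n) →
      (∀ k, w k * (G k + |y k|) ≤ b (n + 1)) ∧
      ∀ y' ∈ X, (∀ k, w k * (G k + |y' k|) ≤ b (n + 1)) → ‖y'‖ ≤ 2 * ‖y‖ := by
    intro n G
    by_cases h : (∀ k, 0 ≤ G k) ∧ ∀ k, w k * G k ≤ b n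
    · obtain ⟨y, hy, h1, h2⟩ := exists_almost_maximal X w (fun k => (hw1 k).le) G h.1 (b (n + 1))
        fun k => (h.2 k).trans (by
          rw [hbsucc]; linarith [show (0 : ℝ) ≤ (1 / 2) ^ (n + 1) by positivity])
      exact ⟨y, hy, fun _ _ => ⟨h1, h2⟩⟩
    · exact ⟨0, X.zero_mem, fun h1 h2 => (h ⟨h1, h2⟩).elim⟩
  choose Y hYX hYmax using hstep
  let G : ℕ → C(K, ℝ) := fun n => Nat.rec 0 (fun n G => G + |Y n G|) n
  have hGsucc : ∀ n k, G (n + 1) k = G n k + |Y n (G n) k| := fun n k => rfl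
  let y : ℕ → C(K, ℝ) := fun n => Y n (G n)
  have hGsum : ∀ n k, G n k = ∑ j ∈ Finset.range n, |y j k| := by
    intro n k
    induction n with
    | zero => rfl
    | succ n ih => rw [Finset.sum_range_succ, ← ih, hGsucc]
  have hG0 : ∀ n k, 0 ≤ G n k := fun n k => by
    rw [hGsum]; exact Finset.sum_nonneg fun _ _ => abs_nonneg _
  have hGb : ∀ n k, w k * G n k ≤ b n := by
    intro n
    induction n with
    | zero =>
      intro k
      have : G 0 k = 0 := rfl
      simp [this, b]
    | succ n ih =>
      intro k
      rw [hGsucc]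
      exact (hYmax n (G n) (hG0 n) ih).1 k
  have hb1 : ∀ n, b n ≤ 1 := fun n => by
    have : (0 : ℝ) ≤ (1 / 2) ^ n := by positivity
    simp only [b]
    linarith
  have hwsum : ∀ (t : Finset ℕ) k, w k * ∑ j ∈ t, |y j k| ≤ 1 := by
    intro t k
    refine le_trans ?_ ((hGb (t.sup id + 1) k).trans (hb1 _))
    refine mul_le_mul_of_nonneg_left (le_of_le_of_eq ?_ (hGsum (t.sup id + 1) k).symm)
      (by linarith [hw1 k])
    exact Finset.sum_le_sum_of_subset_of_nonneg (fun j hj => Finset.mem_range.2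
      (Nat.lt_succ_of_le (Finset.le_sup (f := id) hj))) fun _ _ _ => abs_nonneg _
  have hysum : ∀ (t : Finset ℕ) k, ∑ j ∈ t, |y j k| ≤ 1 := by
    intro t k
    have h1 : (0 : ℝ) ≤ ∑ j ∈ t, |y j k| := Finset.sum_nonneg fun _ _ => abs_nonneg _
    exact (le_mul_of_one_le_left h1 (hw1 k).le).trans (hwsum t k)
  have htail := hU y (fun n => hYX _ _) 1 hysum
  have hys : ∀ k, Summable fun n => |y n k| := fun k =>
    summable_of_sum_le (fun _ => abs_nonneg _) (hysum · k)
  let H : C(K, ℝ) := ⟨fun k => ∑' n, |y n k|, continuous_tsum_of_uniform_tails (fun n => |y n|)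
    (by simpa using hys) (by simpa using htail)⟩
  have hGH : ∀ n k, G n k ≤ H k := fun n k => by
    rw [hGsum]
    exact (hys k).sum_le_tsum _ fun _ _ => abs_nonneg _
  have hH0 : ∀ k, 0 ≤ H k := fun k => tsum_nonneg fun _ => abs_nonneg _
  -- Pointwise `w * H ≤ 1` with `w > 1` gives `H < 1`; continuity of `H` and compactness make the
  -- gap uniform.
  have hH1 : ‖H‖ < 1 := by
    rw [ContinuousMap.norm_lt_iff _ one_pos]
    intro k
    have h1 : w k * H k ≤ 1 := by
      refine le_of_tendsto ((hys k).hasSum.const_mul (w k)) (Eventually.of_forall fun t => ?_)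
      simpa [Finset.mul_sum] using hwsum t k
    rw [Real.norm_of_nonneg (hH0 k)]
    by_contra! hge
    nlinarith [hw1 k]
  let δ : ℝ := (1 - ‖H‖) / 4
  have hδ : 0 < δ := by simp only [δ]; linarith
  have hδ4 : δ ≤ 1 / 4 := by simp only [δ]; linarith [norm_nonneg H]
  have hHδ : ‖H‖ = 1 - 4 * δ := by simp only [δ]; ring
  obtain ⟨m, hm⟩ := htail (δ / 2) (by positivity)
  have hlim : Tendsto (fun n : ℕ => (1 / 2 : ℝ) ^ n) atTop (𝓝 0) :=
    tendsto_pow_atTop_nhds_zero_of_lt_one (by norm_num) (by norm_num)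
  obtain ⟨n₀, hn₀⟩ := eventually_atTop.1 (hlim.eventually (gt_mem_nhds hδ))
  let n := max m n₀
  obtain ⟨z, hzX, hzn, hz⟩ := hsmall (1 / δ) ((1 / 2) ^ (n + 1) / 2) δ (by positivity) hδ
  -- Where `V ≤ 1 / δ`, the tiny `z` fits into the fresh slack, since `w ≤ 2`. Elsewhere `w ≤ 1 +
  -- δ`, and the gap `4 * δ` below 1 absorbs both `|z| ≤ δ` and the weight.
  have hadm : ∀ k, w k * (G n k + |z k|) ≤ b (n + 1) := by
    intro k
    by_cases hk : V k ≤ 1 / δ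
    · have h1 := hz k hk
      have h2 := hGb n k
      have h3 : w k * |z k| ≤ 2 * ((1 / 2) ^ (n + 1) / 2) :=
        mul_le_mul (hw2 k) h1 (abs_nonneg _) (by norm_num)
      rw [hbsucc, mul_add]
      linarith
    · have h1 : w k ≤ 1 + δ := by
        have : 1 / (1 + V k) ≤ δ := by
          rw [div_le_iff₀ (by linarith [hV k])]
          rw [not_le, div_lt_iff₀ hδ] at hk
          nlinarith
        simp only [w]
        linarith
      have h2 : G n k + |z k| ≤ 1 - 3 * δ := by
        have h3 : H k ≤ ‖H‖ := (le_abs_self _).trans (ContinuousMap.norm_coe_le_norm H k)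
        have h4 : |z k| ≤ ‖z‖ := ContinuousMap.norm_coe_le_norm z k
        linarith [hGH n k]
      have h3 : 1 - δ ≤ b (n + 1) := by
        have := hn₀ (n + 1) ((le_max_right m n₀).trans (Nat.le_succ _))
        simp only [b]
        linarith
      calc w k * (G n k + |z k|) ≤ (1 + δ) * (1 - 3 * δ) :=
            mul_le_mul h1 h2 (add_nonneg (hG0 n k) (abs_nonneg _)) (by linarith)
        _ ≤ 1 - δ := by nlinarith
        _ ≤ b (n + 1) := h3
  -- Almost maximality forces `‖y n‖ ≥ δ / 2`, against the small tails of `∑ |y j|`.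
  have h1 : ‖z‖ ≤ 2 * ‖y n‖ := (hYmax n (G n) (hG0 n) (hGb n)).2 z hzX hadm
  have h2 : ‖y n‖ < δ / 2 := by
    rw [ContinuousMap.norm_lt_iff _ (by positivity)]
    intro k
    refine lt_of_le_of_lt ?_ (hm (n + 1) k)
    exact Finset.single_le_sum (f := fun j => |y j k|) (fun _ _ => abs_nonneg _)
      (Finset.mem_Ico.2 ⟨le_max_left m n₀, Nat.lt_succ_self n⟩)
  linarith

end PointwiseSummable

theorem theorem4p1 {K : Type*} [MetricSpace K] [CompactSpace K] (F : K → ℝ)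
    (hF : F ∈ DSC K) (hFc : ¬ Continuous F) :
    Governs F (fun _ : Unit => C₀(ℕ, ℝ)) := by
  refine ⟨?_, fun g hg => ⟨(), ?_⟩⟩
  · obtain ⟨f, hf, -⟩ := hF
    exact ⟨f, hf⟩
  obtain ⟨G, hGspan, hGs, hGF⟩ := exists_blocks_summable hF hg
  have hGX : ∀ j, G j ∈ closedSpan g := fun j => Submodule.le_topologicalClosure _ (hGspan j)
  refine embedsInto_of_pointwise_summable (closedSpan g)
    (Submodule.isClosed_topologicalClosure _) (fun j => G (j + 1) - G j)
    (fun j => Submodule.sub_mem _ (hGX _) (hGX j)) hGs fun hcont => hFc ?_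
  -- The differences telescope to `F - G 0`, so a continuous sum would make `F` continuous.
  have : F = fun k => (∑' n, (G (n + 1) - G n) k) + G 0 k := by
    funext k
    have h1 := (hGs k).of_abs.hasSum.tendsto_sum_nat
    simp_rw [Finset.sum_range_sub (fun n => G n k)] at h1
    have h2 := tendsto_nhds_unique h1 ((hGF k).sub_const (G 0 k))
    simp only [ContinuousMap.sub_apply]
    rw [h2]
    ring
  rw [this]
  exact hcont.add (G 0).continuous
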